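/- Let $\Gamma$ be a countable discrete amenable group and let $(H_i)$ be a (left) Følner sequence of finite subsets of $\Gamma$, i.e. $\#(\gamma H_i\,\triangle\,H_i)/\#H_i\to 0$ for every $\gamma\in\Gamma$. For a measure-preserving action $T=\{T_\gamma\}_{\gamma\in\Gamma}$ on a standard probability space $(X,\mathcal B,\mu)$, a $T$-invariant sub-$\sigma$-algebra $\mathcal A\subseteq\mathcal B$ and a finite measurable partition $P$, put $$h(T,P)=\lim_{i}\frac1{\#H_i}\,h\Big(\bigvee_{\gamma\in H_i}T_{\gamma^{-1}}(P)\Big),\qquad h(T,P\mid\mathcal A)=\lim_{i}\frac1{\#H_i}\,h\Big(\bigvee_{\gamma\in H_i}T_{\gamma^{-1}}(P)\,\Big|\,\mathcal A\Big),$$ where $h(Q)=-\sum_{q\in Q}\mu(q)\log\mu(q)$ and $h(Q\mid\mathcal A)=-\int\sum_{q\in Q}E(1_q\mid\mathcal A)\log E(1_q\mid\mathcal A)\,d\mu$. (These limits exist and do not depend on the Følner sequence.) The action $T$ has completely positive entropy (is cpe) if $h(T,P)>0$ for every finite measurable partition $P$ having an atom of measure neither $0$ nor $1$. It is relatively cpe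 over $\mathcal A$ if the relative Pinsker algebra over $\mathcal A$, that is, the $\sigma$-algebra generated by all finite measurable partitions $P$ with $h(T,P\mid\mathcal A)=0$, equals $\mathcal A$ modulo null sets. The action $T$ is Bernoulli if for some standard probability space $(K,\kappa)$ it is isomorphic (modulo null sets) to the left shift $(T_\gamma y)(\gamma')=y(\gamma^{-1}\gamma')$ on $(K^\Gamma,\kappa^{\Gamma})$. Let $T_1$ and $T_2$ be measure-preserving actions of $\Gamma$ on standard probability spaces $(X_1,\mathcal B_1,\mu_1)$ and $(X_2,\mathcal B_2,\mu_2)$. If $T_1$ is Bernoulli and $T_2$ is cpe, then the product action $T_1\times T_2=\{T_{1,\gamma}\times T_{2,\gamma}\}_{\gamma\in\Gamma}$ on $(X_1\times X_2,\mu_1\times\mu_2)$ is relatively cpe over $X_1$, i.e. over the $\sigma$-algebra $\{B\times X_2: B\in\mathcal B_1\}$ of the first coordinate. -/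

import Mathlib

open MeasureTheory Filter Topology

namespace AmenableEntropy

/-- Entropy `h(P) = -∑ᵢ μ(Pᵢ) log μ(Pᵢ)` of a finite partition, given by its label map
`P : X → ι` (the atoms are the sets `P ⁻¹' {i}`). -/
noncomputable def entropy {X ι : Type*} [MeasurableSpace X] [Fintype ι]
    (μ : Measure X) (P : X → ι) : ℝ :=
  ∑ i, Real.negMulLog (μ.real (P ⁻¹' {i}))

/-- Conditional entropy `h(P | 𝒜) = ∫ H(E(P | 𝒜)(x)) dμ(x)`: the entropy of the vector of
conditional probabilities of the atoms of `P` given `𝒜`, integrated. -/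
noncomputable def condEntropy {X ι : Type*} (𝒜 : MeasurableSpace X) [mX : MeasurableSpace X]
    [Fintype ι] (μ : Measure X) (P : X → ι) : ℝ :=
  ∫ x, ∑ i, Real.negMulLog ((μ[(P ⁻¹' {i}).indicator (fun _ => (1 : ℝ)) | 𝒜]) x) ∂μ

/-- The label map of the join `⋁_{γ ∈ F} T_{γ⁻¹}(P)`: the label of `x` is `(P(T_γ x))_{γ ∈ F}`. -/
def join {Γ X ι : Type*} [SMul Γ X] (F : Finset Γ) (P : X → ι) (x : X) : F → ι :=
  fun γ => P ((γ : Γ) • x)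

open scoped Classical in
/-- Entropy of the process: `h(T, P) = lim_i (1 / #H_i) h(⋁_{γ ∈ H_i} T_{γ⁻¹}(P))`.
For a Følner sequence `H` the limit exists; it is written as an upper limit, which equals the limit
and is meaningful without appeal to that theorem (the sequence lies in `[0, log #ι]`). -/
noncomputable def processEntropy {Γ X ι : Type*} [SMul Γ X] [MeasurableSpace X] [Fintype ι]
    (H : ℕ → Finset Γ) (μ : Measure X) (P : X → ι) : ℝ :=
  limsup (fun i => entropy μ (join (H i) P) / ((H i).card : ℝ)) atTop

open scoped Classical in
/-- Conditional entropy of the process: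
`h(T, P | 𝒜) = lim_i (1 / #H_i) h(⋁_{γ ∈ H_i} T_{γ⁻¹}(P) | 𝒜)`, for an invariant `𝒜`; again the
limit is written as an upper limit. -/
noncomputable def condProcessEntropy {Γ X ι : Type*} [SMul Γ X] (𝒜 : MeasurableSpace X)
    [mX : MeasurableSpace X] [Fintype ι] (H : ℕ → Finset Γ) (μ : Measure X) (P : X → ι) : ℝ :=
  limsup (fun i => condEntropy 𝒜 μ (join (H i) P) / ((H i).card : ℝ)) atTop

/-- Completely positive entropy: `h(T, P) > 0` for every nontrivial finite measurable partition,
i.e. one having an atom of measure neither `0` nor `1`. -/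
def IsCPE {Γ X : Type*} [SMul Γ X] [MeasurableSpace X] (H : ℕ → Finset Γ) (μ : Measure X) : Prop :=
  ∀ (n : ℕ) (P : X → Fin n), Measurable P → (∃ i, μ (P ⁻¹' {i}) ≠ 0 ∧ μ (P ⁻¹' {i}) ≠ 1) →
    0 < processEntropy H μ P

/-- The relative Pinsker algebra over `𝒜`: the σ-algebra generated by (the atoms of) all finite
measurable partitions `P` with `h(T, P | 𝒜) = 0`. -/
@[reducible] def relPinsker {Γ X : Type*} [SMul Γ X] (𝒜 : MeasurableSpace X) [mX : MeasurableSpace X]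
    (H : ℕ → Finset Γ) (μ : Measure X) : MeasurableSpace X :=
  MeasurableSpace.generateFrom
    {s | ∃ (n : ℕ) (P : X → Fin n), Measurable[mX] P ∧
      condProcessEntropy 𝒜 H μ P = 0 ∧ ∃ i, s = P ⁻¹' {i}}

/-- Two σ-algebras on `X` agree modulo `μ`-null sets. -/
def EqModNull {X : Type*} (𝒜 ℬ : MeasurableSpace X) [mX : MeasurableSpace X]
    (μ : Measure X) : Prop :=
  (∀ s, MeasurableSet[𝒜] s → ∃ t, MeasurableSet[ℬ] t ∧ s =ᵐ[μ] t) ∧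
    (∀ t, MeasurableSet[ℬ] t → ∃ s, MeasurableSet[𝒜] s ∧ s =ᵐ[μ] t)

/-- Relatively cpe over `𝒜`: the relative Pinsker algebra over `𝒜` is just `𝒜` (mod null sets). -/
def IsRelCPE {Γ X : Type*} [SMul Γ X] (𝒜 : MeasurableSpace X) [mX : MeasurableSpace X]
    (H : ℕ → Finset Γ) (μ : Measure X) : Prop :=
  EqModNull (relPinsker 𝒜 H μ) 𝒜 μ

/-- The action is Bernoulli: for some standard probability space `(K, κ)` it is isomorphic, modulo
null sets, to the left shift `(T_γ y)(γ') = y(γ⁻¹ γ')` on `(K^Γ, κ^Γ)`.  (Every standard Borel space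
is isomorphic to one in `Type`.) -/
def IsBernoulli (Γ : Type*) {X : Type*} [Group Γ] [SMul Γ X] [MeasurableSpace X]
    (μ : Measure X) : Prop :=
  ∃ (K : Type) (_ : MeasurableSpace K) (_ : StandardBorelSpace K)
    (κ : Measure K) (_ : IsProbabilityMeasure κ) (φ : X → Γ → K) (ψ : (Γ → K) → X),
    MeasurePreserving φ μ (Measure.infinitePi fun _ : Γ => κ) ∧
    Measurable ψ ∧
    (∀ᵐ x ∂μ, ψ (φ x) = x) ∧
    (∀ᵐ y ∂(Measure.infinitePi fun _ : Γ => κ), φ (ψ y) = y) ∧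
    ∀ γ : Γ, ∀ᵐ x ∂μ, φ (γ • x) = fun γ' => φ x (γ⁻¹ * γ')

end AmenableEntropy

/-!
# Relative entropy in a product action, by Shearer's inequality

Let `P` be a finite partition of `X₁ × X₂` with zero entropy relative to `X₁`, let `S` be one of its
atoms, and suppose that the slices `S_x ⊆ X₂` are not almost surely trivial. As the measure algebra
of `μ₂` is separable, some nontrivial slice `s = S_{x₀}` lies in the support of the distribution of
`x ↦ S_x` (`ae_forall_measure_slice_close_pos`): for each `δ`, the set `A` of those `x` for which
`S_x` is `δ`-close to `s` has positive measure. By complete positivity, `Q = {s, sᶜ}` has positive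
entropy in `X₂`.

Over a point `x`, the join of the translates of `P` over a finite set `F` is a partition of `X₂`
which, up to a small error per time, refines the join of the translates of `Q` over the set
`R = {γ ∈ F | γ • x ∈ A}` of times at which `x` visits `A`. By invariance of `μ₁`, the random set `R`
contains each `γ ∈ F` with probability `μ₁ A`. Shearer's inequality says that the expected entropy
of the join of `Q` over such a set is at least `μ₁ A` times the entropy of the join over all of `F`;
it follows from submodularity of entropy (`entropy_submodular`,
`exists_additive_le_of_submodular`). Hence `h(T₁ × T₂, P | X₁) ≥ μ₁ A · (h(T₂, Q) - error) > 0`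
(`mul_entropy_join_le`, `ae_measure_slice_eq_zero_or_one`), a contradiction. So almost every slice
is trivial, which means that `S` is the preimage of a subset of `X₁` modulo null sets.

The argument takes the independence of the two coordinates from the product measure alone. All
inequalities hold for each finite set `F`, so they pass directly to the upper limits along `H`.
-/

namespace AmenableEntropy

/-! ### Entropy of finite-valued maps -/

section Entropy

variable {X α β δ : Type*} [MeasurableSpace X] {μ : Measure X}

open scoped Classical in
theorem measureReal_preimage_comp [IsFiniteMeasure μ] [Fintype α]
    [MeasurableSpace α] [MeasurableSingletonClass α] {U : X → α} (hU : Measurable U)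
    (g : α → β) (b : β) :
    μ.real ((fun x => g (U x)) ⁻¹' {b}) = ∑ a with g a = b, μ.real (U ⁻¹' {a}) := by
  rw [← measureReal_biUnion_finset]
  · congr 1
    ext x
    simp
  · intro a _ a' _ h
    exact Disjoint.preimage _ (by simpa using h)
  · intro a _
    exact hU (measurableSet_singleton a)

/-- Applying a function to a finite-valued map does not increase its entropy. -/
theorem entropy_comp_le [IsFiniteMeasure μ] [Fintype α] [MeasurableSpace α] [MeasurableSingletonClass α]
    [Fintype β] {U : X → α} (hU : Measurable U) (g : α → β) :
    entropy μ (fun x => g (U x)) ≤ entropy μ U := by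
  classical
  unfold entropy
  rw [← Finset.sum_fiberwise Finset.univ g]
  refine Finset.sum_le_sum fun b _ => ?_
  rw [measureReal_preimage_comp hU g b, Real.negMulLog, neg_mul, Finset.sum_mul,
    ← Finset.sum_neg_distrib]
  refine Finset.sum_le_sum fun a ha => ?_
  rw [Real.negMulLog, neg_mul, neg_le_neg_iff]
  rcases (measureReal_nonneg (μ := μ) (s := U ⁻¹' {a})).eq_or_lt with h | h
  · simp [← h]
  · refine mul_le_mul_of_nonneg_left (Real.log_le_log h ?_) h.le
    exact Finset.single_le_sum (f := fun a => μ.real (U ⁻¹' {a}))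
      (fun _ _ => measureReal_nonneg) ha

theorem entropy_nonneg [Fintype α] [IsProbabilityMeasure μ] (U : X → α) : 0 ≤ entropy μ U :=
  Finset.sum_nonneg fun _ _ => Real.negMulLog_nonneg measureReal_nonneg measureReal_le_one

/-- A crude bound, from `-t log t ≤ 1 - t`. -/
theorem entropy_le_card [Fintype α] (μ : Measure X) (U : X → α) : entropy μ U ≤ Fintype.card α := by
  have h : ∀ t : ℝ, 0 ≤ t → Real.negMulLog t ≤ 1 := by
    intro t ht
    exact (Real.negMulLog_le_one_sub_self ht).trans (by linarith)
  calc entropy μ U ≤ ∑ _i : α, (1 : ℝ) := Finset.sum_le_sum fun i _ => h _ measureReal_nonneg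
    _ = Fintype.card α := by simp

/-- Submodularity for one nonnegative matrix: with `t` the total mass, the entropy of the entries
and that of `t` together are at most the entropies of the row sums and of the column sums. -/
theorem sum_negMulLog_add_le [Fintype α] [Fintype δ] (q : α → δ → ℝ) (hq : ∀ a c, 0 ≤ q a c) :
    ∑ a, ∑ c, Real.negMulLog (q a c) + Real.negMulLog (∑ a, ∑ c, q a c) ≤
      ∑ a, Real.negMulLog (∑ c, q a c) + ∑ c, Real.negMulLog (∑ a, q a c) := by
  set r : α → ℝ := fun a => ∑ c, q a c with hr
  set s : δ → ℝ := fun c => ∑ a, q a c with hs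
  set t : ℝ := ∑ a, ∑ c, q a c with ht
  have hts : t = ∑ c, s c := Finset.sum_comm
  have key : ∀ a c, q a c * (Real.log (r a) + Real.log (s c) - Real.log (q a c) - Real.log t) ≤
      r a * s c / t - q a c := by
    intro a c
    have hqr : q a c ≤ r a := Finset.single_le_sum (fun c _ => hq a c) (Finset.mem_univ c)
    have hqs : q a c ≤ s c :=
      Finset.single_le_sum (f := fun a => q a c) (fun a _ => hq a c) (Finset.mem_univ a)
    have hrt : r a ≤ t := Finset.single_le_sum (f := r)
      (fun a _ => Finset.sum_nonneg fun c _ => hq a c) (Finset.mem_univ a)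
    rcases (hq a c).eq_or_lt with h | h
    · rw [← h]
      have h1 : 0 ≤ r a := (hq a c).trans hqr
      have h2 : 0 ≤ s c := (hq a c).trans hqs
      have h3 : 0 ≤ t := h1.trans hrt
      simp only [zero_mul, sub_zero]
      positivity
    · have h1 : 0 < r a := h.trans_le hqr
      have h2 : 0 < s c := h.trans_le hqs
      have h3 : 0 < t := h1.trans_le hrt
      have hlog : Real.log (r a) + Real.log (s c) - Real.log (q a c) - Real.log t =
          Real.log (r a * s c / (q a c * t)) := by
        rw [Real.log_div (by positivity) (by positivity), Real.log_mul h1.ne' h2.ne',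
          Real.log_mul h.ne' h3.ne']
        ring
      rw [hlog]
      calc q a c * Real.log (r a * s c / (q a c * t))
          ≤ q a c * (r a * s c / (q a c * t) - 1) :=
            mul_le_mul_of_nonneg_left (Real.log_le_sub_one_of_pos (by positivity)) h.le
        _ = r a * s c / t - q a c := by field_simp
  have hsum : ∑ a, ∑ c,
      q a c * (Real.log (r a) + Real.log (s c) - Real.log (q a c) - Real.log t) ≤ 0 := by
    refine (Finset.sum_le_sum fun a _ => Finset.sum_le_sum fun c _ => key a c).trans ?_
    simp only [Finset.sum_sub_distrib, ← Finset.sum_div, ← Finset.mul_sum, ← Finset.sum_mul]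
    rw [← hts]
    change t * t / t - t ≤ 0
    rw [mul_self_div_self, sub_self]
  have e1 : ∑ a, Real.negMulLog (r a) = -∑ a, ∑ c, q a c * Real.log (r a) := by
    simp only [← Finset.sum_mul, Real.negMulLog, neg_mul, Finset.sum_neg_distrib]
    rfl
  have e2 : ∑ c, Real.negMulLog (s c) = -∑ a, ∑ c, q a c * Real.log (s c) := by
    rw [Finset.sum_comm]
    simp only [← Finset.sum_mul, Real.negMulLog, neg_mul, Finset.sum_neg_distrib]
    rfl
  have e3 : Real.negMulLog t = -∑ a, ∑ c, q a c * Real.log t := by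
    simp only [← Finset.sum_mul, Real.negMulLog, neg_mul]
    rfl
  have e4 : ∑ a, ∑ c, Real.negMulLog (q a c) = -∑ a, ∑ c, q a c * Real.log (q a c) := by
    simp only [Real.negMulLog, neg_mul, Finset.sum_neg_distrib]
  simp only [mul_sub, mul_add, Finset.sum_sub_distrib, Finset.sum_add_distrib] at hsum
  rw [e1, e2, e3, e4]
  linarith

/-- Submodularity (strong subadditivity) of entropy. -/
theorem entropy_submodular [IsFiniteMeasure μ]
    [Fintype α] [MeasurableSpace α] [MeasurableSingletonClass α]
    [Fintype β] [MeasurableSpace β] [MeasurableSingletonClass β]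
    [Fintype δ] [MeasurableSpace δ] [MeasurableSingletonClass δ]
    {U : X → α} {V : X → β} {W : X → δ}
    (hU : Measurable U) (hV : Measurable V) (hW : Measurable W) :
    entropy μ (fun x => (V x, U x, W x)) + entropy μ V ≤
      entropy μ (fun x => (V x, U x)) + entropy μ (fun x => (V x, W x)) := by
  classical
  have hT : Measurable fun x => (V x, U x, W x) := hV.prodMk (hU.prodMk hW)
  set p : β → α → δ → ℝ := fun b a c => μ.real ((fun x => (V x, U x, W x)) ⁻¹' {(b, a, c)})
  have h1 : ∀ b, μ.real (V ⁻¹' {b}) = ∑ a, ∑ c, p b a c := by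
    intro b
    have := measureReal_preimage_comp (μ := μ) hT Prod.fst b
    rw [show V ⁻¹' {b} = (fun x => (V x, U x, W x).1) ⁻¹' {b} from rfl, this,
      Finset.sum_filter, Fintype.sum_prod_type, Fintype.sum_eq_single b]
    · simp [Fintype.sum_prod_type, p]
    · intro b' hb'
      simp [hb']
  have h2 : ∀ b a, μ.real ((fun x => (V x, U x)) ⁻¹' {(b, a)}) = ∑ c, p b a c := by
    intro b a
    have := measureReal_preimage_comp (μ := μ) hT (fun z => (z.1, z.2.1)) (b, a)
    simp only at this
    rw [this, Finset.sum_filter, Fintype.sum_prod_type, Fintype.sum_eq_single b,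
      Fintype.sum_prod_type, Fintype.sum_eq_single a]
    · simp [p]
    · intro a' ha'
      simp [ha']
    · intro b' hb'
      simp [hb']
  have h3 : ∀ b c, μ.real ((fun x => (V x, W x)) ⁻¹' {(b, c)}) = ∑ a, p b a c := by
    intro b c
    have := measureReal_preimage_comp (μ := μ) hT (fun z => (z.1, z.2.2)) (b, c)
    simp only at this
    rw [this, Finset.sum_filter, Fintype.sum_prod_type, Fintype.sum_eq_single b,
      Fintype.sum_prod_type]
    · simp [p]
    · intro b' hb'
      simp [hb']
  simp only [entropy, Fintype.sum_prod_type, h1, h2, h3, ← Finset.sum_add_distrib]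
  refine Finset.sum_le_sum fun b _ => ?_
  exact sum_negMulLog_add_le (p b) fun a c => measureReal_nonneg

theorem entropy_prodMk_le [IsProbabilityMeasure μ]
    [Fintype α] [MeasurableSpace α] [MeasurableSingletonClass α]
    [Fintype δ] [MeasurableSpace δ] [MeasurableSingletonClass δ]
    {U : X → α} {W : X → δ}
    (hU : Measurable U) (hW : Measurable W) :
    entropy μ (fun x => (U x, W x)) ≤ entropy μ U + entropy μ W := by
  have h := entropy_submodular (μ := μ) (V := fun _ => ()) hU measurable_const hW
  have h1 := entropy_comp_le (μ := μ)
    (measurable_const.prodMk (hU.prodMk hW) : Measurable fun x => ((), U x, W x)) Prod.snd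
  have h2 := entropy_comp_le (μ := μ) hU (fun a => ((), a))
  have h3 := entropy_comp_le (μ := μ) hW (fun a => ((), a))
  have h4 := entropy_nonneg (μ := μ) (fun _ : X => ())
  linarith

end Entropy

/-! ### Joins of families of partitions -/

section Family

variable {Γ X ι κ ν : Type*}

/-- The label map of the join of the partitions `Y γ`, `γ ∈ F`. -/
def familyJoin (F : Finset Γ) (Y : Γ → X → ι) (x : X) : F → ι := fun γ => Y γ x

theorem familyJoin_eq_iff {F : Finset Γ} {Y : Γ → X → ι} {x x' : X} :
    familyJoin F Y x = familyJoin F Y x' ↔ ∀ γ ∈ F, Y γ x = Y γ x' :=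
  ⟨fun h γ hγ => congrFun h ⟨γ, hγ⟩, fun h => funext fun γ => h γ γ.2⟩

variable [MeasurableSpace X] {μ : Measure X}

/-- If the value of `V` determines that of `U`, then `U` has at most the entropy of `V`. -/
theorem entropy_le_of_factorsThrough {α β : Type*} [IsProbabilityMeasure μ]
    [Fintype α] [Fintype β] [MeasurableSpace β] [MeasurableSingletonClass β]
    {U : X → α} {V : X → β} (hV : Measurable V) (h : U.FactorsThrough V) :
    entropy μ U ≤ entropy μ V := by
  obtain ⟨x⟩ : Nonempty X := nonempty_of_isProbabilityMeasure μ
  have : Nonempty α := ⟨U x⟩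
  obtain ⟨g, rfl⟩ := (Function.factorsThrough_iff U).1 h
  exact entropy_comp_le hV g

theorem measurable_familyJoin [MeasurableSpace ι] {F : Finset Γ} {Y : Γ → X → ι}
    (hY : ∀ γ, Measurable (Y γ)) : Measurable (familyJoin F Y) :=
  measurable_pi_lambda _ fun γ => hY γ

open scoped Classical in
theorem entropy_familyJoin_empty [IsProbabilityMeasure μ] [Fintype ι] (Y : Γ → X → ι) :
    entropy μ (familyJoin ∅ Y) = 0 := by
  have h : ∀ i : (∅ : Finset Γ) → ι, familyJoin ∅ Y ⁻¹' {i} = Set.univ := fun i =>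
    Set.eq_univ_of_forall fun x => funext fun γ => absurd γ.2 (Finset.notMem_empty _)
  simp [entropy, h]

open scoped Classical in
theorem entropy_familyJoin_le_sum [IsProbabilityMeasure μ] [Fintype ι] [MeasurableSpace ι]
    [MeasurableSingletonClass ι] {Y : Γ → X → ι} (hY : ∀ γ, Measurable (Y γ)) (F : Finset Γ) :
    entropy μ (familyJoin F Y) ≤ ∑ γ ∈ F, entropy μ (Y γ) := by
  induction F using Finset.induction_on with
  | empty => simp [entropy_familyJoin_empty]
  | insert a F ha ih =>
    rw [Finset.sum_insert ha]
    have hm := measurable_familyJoin (F := F) hY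
    have h1 := entropy_prodMk_le (μ := μ) (hY a) hm
    have h2 : entropy μ (familyJoin (insert a F) Y) ≤
        entropy μ (fun x => (Y a x, familyJoin F Y x)) := by
      refine entropy_le_of_factorsThrough ((hY a).prodMk hm) fun x x' h => ?_
      simp only [Prod.mk.injEq, familyJoin_eq_iff] at h
      rw [familyJoin_eq_iff]
      intro γ hγ
      rcases Finset.mem_insert.1 hγ with rfl | hγ
      exacts [h.1, h.2 γ hγ]
    linarith

open scoped Classical in
/-- Submodularity of `F ↦ h(⋁_{γ ∈ F} Y γ)`, in the form of diminishing increments. -/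
theorem entropy_familyJoin_submodular [IsProbabilityMeasure μ] [Fintype ι] [MeasurableSpace ι]
    [MeasurableSingletonClass ι] {Y : Γ → X → ι} (hY : ∀ γ, Measurable (Y γ))
    {R S : Finset Γ} (hRS : R ⊆ S) (a : Γ) :
    entropy μ (familyJoin (insert a S) Y) + entropy μ (familyJoin R Y) ≤
      entropy μ (familyJoin (insert a R) Y) + entropy μ (familyJoin S Y) := by
  have hm : ∀ F : Finset Γ, Measurable (familyJoin F Y) := fun F => measurable_familyJoin hY
  have h0 := entropy_submodular (μ := μ) (hY a) (hm R) (hm S)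
  have h1 : entropy μ (familyJoin (insert a S) Y) ≤
      entropy μ (fun x => (familyJoin R Y x, Y a x, familyJoin S Y x)) := by
    refine entropy_le_of_factorsThrough ((hm R).prodMk ((hY a).prodMk (hm S))) fun x x' h => ?_
    simp only [Prod.mk.injEq, familyJoin_eq_iff] at h
    rw [familyJoin_eq_iff]
    intro γ hγ
    rcases Finset.mem_insert.1 hγ with rfl | hγ
    exacts [h.2.1, h.2.2 γ hγ]
  have h2 : entropy μ (fun x => (familyJoin R Y x, Y a x)) ≤
      entropy μ (familyJoin (insert a R) Y) := by
    refine entropy_le_of_factorsThrough (hm _) fun x x' h => ?_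
    rw [familyJoin_eq_iff] at h
    simp only [Prod.mk.injEq, familyJoin_eq_iff]
    exact ⟨fun γ hγ => h γ (Finset.mem_insert_of_mem hγ), h a (Finset.mem_insert_self a R)⟩
  have h3 : entropy μ (fun x => (familyJoin R Y x, familyJoin S Y x)) ≤
      entropy μ (familyJoin S Y) := by
    refine entropy_le_of_factorsThrough (hm _) fun x x' h => ?_
    rw [familyJoin_eq_iff] at h
    simp only [Prod.mk.injEq, familyJoin_eq_iff]
    exact ⟨fun γ hγ => h γ (hRS hγ), h⟩
  linarith

/-- A submodular set function with `f ∅ = 0` dominates an additive one that agrees with it on `F`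
(a point of its base polytope). Summing over a random subset of `F` gives Shearer's inequality. -/
theorem exists_additive_le_of_submodular [DecidableEq Γ] {f : Finset Γ → ℝ} (h0 : f ∅ = 0)
    (hf : ∀ ⦃R S : Finset Γ⦄, R ⊆ S → ∀ a, f (insert a S) + f R ≤ f (insert a R) + f S)
    (F : Finset Γ) :
    ∃ c : Γ → ℝ, ∑ γ ∈ F, c γ = f F ∧ ∀ R ⊆ F, ∑ γ ∈ R, c γ ≤ f R := by
  induction F using Finset.induction_on with
  | empty =>
    refine ⟨0, by simp [h0], fun R hR => ?_⟩
    rw [Finset.subset_empty.1 hR]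
    simp [h0]
  | insert a F ha ih =>
    obtain ⟨c, hc, hcR⟩ := ih
    have hsum : ∀ R : Finset Γ, a ∉ R →
        ∑ γ ∈ R, Function.update c a (f (insert a F) - f F) γ = ∑ γ ∈ R, c γ := fun R hR =>
      Finset.sum_congr rfl fun γ hγ => Function.update_of_ne (ne_of_mem_of_not_mem hγ hR) _ _
    refine ⟨Function.update c a (f (insert a F) - f F), ?_, fun R hR => ?_⟩
    · rw [Finset.sum_insert ha, hsum F ha, Function.update_self, hc]
      ring
    · by_cases haR : a ∈ R
      · have hR' : R.erase a ⊆ F := by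
          rw [← Finset.erase_insert ha]
          exact Finset.erase_subset_erase a hR
        have h1 := hf hR' a
        rw [Finset.insert_erase haR] at h1
        rw [← Finset.add_sum_erase _ _ haR, hsum _ (Finset.notMem_erase a R),
          Function.update_self]
        linarith [hcR _ hR']
      · rw [hsum R haR]
        exact hcR R ((Finset.subset_insert_iff_of_notMem haR).1 hR)

open scoped Classical in
/-- If, for `γ` in a subset `R` of `F`, the labels `Y γ` and `W γ` determine the label `Q γ`, then
replacing `Y` by `Q` and `F` by `R` costs at most the entropies of the `W γ`. -/
theorem entropy_familyJoin_le_add_sum [IsProbabilityMeasure μ]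
    [Fintype ι] [MeasurableSpace ι] [MeasurableSingletonClass ι] [Fintype κ]
    [Fintype ν] [MeasurableSpace ν] [MeasurableSingletonClass ν]
    {Y : Γ → X → ι} (hY : ∀ γ, Measurable (Y γ)) {W : Γ → X → ν} (hW : ∀ γ, Measurable (W γ))
    {Q : Γ → X → κ} {R F : Finset Γ} (hRF : R ⊆ F)
    (hQ : ∀ γ ∈ R, ∀ x x', Y γ x = Y γ x' → W γ x = W γ x' → Q γ x = Q γ x') :
    entropy μ (familyJoin R Q) ≤ entropy μ (familyJoin F Y) + ∑ γ ∈ R, entropy μ (W γ) := by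
  have hYF := measurable_familyJoin (F := F) hY
  have hWR := measurable_familyJoin (F := R) hW
  have h1 : entropy μ (familyJoin R Q) ≤
      entropy μ (fun x => (familyJoin F Y x, familyJoin R W x)) := by
    refine entropy_le_of_factorsThrough (hYF.prodMk hWR) fun x x' h => ?_
    simp only [Prod.mk.injEq, familyJoin_eq_iff] at h
    rw [familyJoin_eq_iff]
    exact fun γ hγ => hQ γ hγ x x' (h.1 γ (hRF hγ)) (h.2 γ hγ)
  have h2 := entropy_prodMk_le (μ := μ) hYF hWR
  have h3 := entropy_familyJoin_le_sum (μ := μ) hW R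
  linarith

end Family

/-! ### Partitions into a set and its complement -/

open scoped Classical symmDiff

theorem entropy_decide_mem {X : Type*} [MeasurableSpace X] (μ : Measure X)
    [IsProbabilityMeasure μ] {s : Set X} (hs : MeasurableSet s) :
    entropy μ (fun x => decide (x ∈ s)) =
      Real.negMulLog (μ.real s) + Real.negMulLog (1 - μ.real s) := by
  have h1 : (fun x => decide (x ∈ s)) ⁻¹' {true} = s := by ext; simp
  have h2 : (fun x => decide (x ∈ s)) ⁻¹' {false} = sᶜ := by ext; simp
  rw [entropy, Fintype.sum_bool, h1, h2, probReal_compl_eq_one_sub hs]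

theorem exists_entropy_decide_mem_lt {X : Type*} [MeasurableSpace X] (μ : Measure X)
    [IsProbabilityMeasure μ] {ε : ℝ} (hε : 0 < ε) :
    ∃ δ > 0, ∀ s : Set X, MeasurableSet s → μ.real s < δ →
      entropy μ (fun x => decide (x ∈ s)) < ε := by
  have hc : Continuous fun t : ℝ => Real.negMulLog t + Real.negMulLog (1 - t) := by fun_prop
  have h := hc.tendsto 0
  simp only [Real.negMulLog_zero, sub_zero, Real.negMulLog_one, add_zero] at h
  obtain ⟨δ, hδ, hlt⟩ := Metric.eventually_nhds_iff.1 (h.eventually_lt_const hε)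
  refine ⟨δ, hδ, fun s hs hsδ => ?_⟩
  rw [entropy_decide_mem μ hs]
  refine hlt ?_
  rwa [Real.dist_eq, sub_zero, abs_of_nonneg measureReal_nonneg]

/-! ### Slices of subsets of a product -/

section Product

variable {X₁ X₂ : Type*} [MeasurableSpace X₁] [MeasurableSpace X₂]
  {μ₁ : Measure X₁} {μ₂ : Measure X₂}

/-- Almost every slice of a measurable set lies in the support of the distribution of the random
slice: since the measure algebra of `μ₂` is separable, countably many null balls of slices
contain all those that do not. -/
theorem ae_forall_measure_slice_close_pos [MeasurableSpace.CountablyGenerated X₂]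
    [IsProbabilityMeasure μ₂] {S : Set (X₁ × X₂)} (hS : MeasurableSet S) :
    ∀ᵐ x₀ ∂μ₁, ∀ δ : ℝ, 0 < δ →
      μ₁ {x | μ₂.real ((Prod.mk x ⁻¹' S) ∆ (Prod.mk x₀ ⁻¹' S)) < δ} ≠ 0 := by
  obtain ⟨𝒟, h𝒟c, h𝒟⟩ := exists_countable_measureDense (μ := μ₂)
  have hS' : ∀ x, MeasurableSet (Prod.mk x ⁻¹' S) := fun x => measurable_prodMk_left hS
  have hball : ∀ t ∈ 𝒟, ∀ n : ℕ, ∀ᵐ x₀ ∂μ₁,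
      μ₂.real ((Prod.mk x₀ ⁻¹' S) ∆ t) < 1 / (n + 1 : ℝ) →
      μ₁ {x | μ₂.real ((Prod.mk x ⁻¹' S) ∆ t) < 1 / (n + 1 : ℝ)} ≠ 0 := by
    intro t _ n
    by_cases h : μ₁ {x | μ₂.real ((Prod.mk x ⁻¹' S) ∆ t) < 1 / (n + 1 : ℝ)} = 0
    · have h' : ∀ᵐ x ∂μ₁, ¬ μ₂.real ((Prod.mk x ⁻¹' S) ∆ t) < 1 / (n + 1 : ℝ) := by
        rw [ae_iff]
        simpa using h
      filter_upwards [h'] with x hx hx'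
      exact absurd hx' hx
    · exact Eventually.of_forall fun _ _ => h
  have hall := (ae_ball_iff h𝒟c).2 fun t ht => ae_all_iff.2 (hball t ht)
  filter_upwards [hall] with x₀ hx₀ δ hδ
  obtain ⟨n, hn⟩ := exists_nat_one_div_lt (half_pos hδ)
  have hpos : (0 : ℝ) < 1 / (n + 1 : ℝ) := by positivity
  obtain ⟨t, ht, hts⟩ := h𝒟.approx _ (hS' x₀) (measure_ne_top _ _) _ hpos
  have hts' : μ₂.real ((Prod.mk x₀ ⁻¹' S) ∆ t) < 1 / (n + 1 : ℝ) :=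
    (ENNReal.lt_ofReal_iff_toReal_lt (measure_ne_top _ _)).1 hts
  refine fun h0 => hx₀ t ht n hts' (measure_mono_null (fun x hx => ?_) h0)
  have hx : μ₂.real ((Prod.mk x ⁻¹' S) ∆ t) < 1 / (n + 1 : ℝ) := hx
  calc μ₂.real ((Prod.mk x ⁻¹' S) ∆ (Prod.mk x₀ ⁻¹' S))
      ≤ μ₂.real ((Prod.mk x ⁻¹' S) ∆ t) + μ₂.real (t ∆ (Prod.mk x₀ ⁻¹' S)) :=
        measureReal_symmDiff_le _
    _ < δ := by
        rw [symmDiff_comm t]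
        linarith

/-- Given the first coordinate `x`, the conditional probability of `S` is the measure of its slice
over `x`. -/
theorem measureReal_slice_ae_eq_condExp [IsProbabilityMeasure μ₁] [IsProbabilityMeasure μ₂]
    {S : Set (X₁ × X₂)} (hS : MeasurableSet S) :
    (fun z : X₁ × X₂ => μ₂.real (Prod.mk z.1 ⁻¹' S)) =ᵐ[μ₁.prod μ₂]
      (μ₁.prod μ₂)[S.indicator (fun _ => (1 : ℝ)) |
        MeasurableSpace.comap (Prod.fst : X₁ × X₂ → X₁) inferInstance] := by
  have hm : Measurable fun x => μ₂.real (Prod.mk x ⁻¹' S) :=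
    (measurable_measure_prodMk_left hS).ennreal_toReal
  have hint : Integrable (fun z : X₁ × X₂ => μ₂.real (Prod.mk z.1 ⁻¹' S)) (μ₁.prod μ₂) :=
    Integrable.of_bound (hm.comp measurable_fst).aestronglyMeasurable 1
      (Eventually.of_forall fun z => by
        rw [Real.norm_of_nonneg measureReal_nonneg]
        exact measureReal_le_one)
  refine ae_eq_condExp_of_forall_setIntegral_eq measurable_fst.comap_le
    ((integrable_const 1).indicator hS) (fun s _ _ => hint.integrableOn) ?_
    (hm.comp (comap_measurable Prod.fst)).stronglyMeasurable.aestronglyMeasurable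
  rintro _ ⟨B, hB, rfl⟩ -
  have hpre : (Prod.fst : X₁ × X₂ → X₁) ⁻¹' B = B ×ˢ Set.univ := by ext; simp
  rw [hpre, setIntegral_prod _ hint.integrableOn,
    setIntegral_prod _ ((integrable_const 1).indicator hS).integrableOn]
  refine setIntegral_congr_fun hB fun x _ => ?_
  have h1 : ∀ y, S.indicator (fun _ => (1 : ℝ)) (x, y) =
      (Prod.mk x ⁻¹' S).indicator (fun _ => (1 : ℝ)) y := fun y => rfl
  simp only [h1]
  rw [Measure.restrict_univ, integral_indicator_const _ (measurable_prodMk_left hS)]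
  simp

theorem measurable_entropy_slice {α : Type*} [Fintype α] [MeasurableSpace α]
    [MeasurableSingletonClass α] [IsProbabilityMeasure μ₂] {U : X₁ × X₂ → α} (hU : Measurable U) :
    Measurable fun x => entropy μ₂ (fun y => U (x, y)) :=
  Finset.measurable_sum _ fun i _ => Real.continuous_negMulLog.measurable.comp
    (measurable_measure_prodMk_left (hU (measurableSet_singleton i))).ennreal_toReal

theorem integrable_entropy_slice {α : Type*} [Fintype α] [MeasurableSpace α]
    [MeasurableSingletonClass α] [IsProbabilityMeasure μ₁] [IsProbabilityMeasure μ₂]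
    {U : X₁ × X₂ → α} (hU : Measurable U) :
    Integrable (fun x => entropy μ₂ (fun y => U (x, y))) μ₁ :=
  Integrable.of_bound (measurable_entropy_slice hU).aestronglyMeasurable (Fintype.card α)
    (Eventually.of_forall fun x => by
      rw [Real.norm_of_nonneg (entropy_nonneg _)]
      exact entropy_le_card _ _)

/-- Conditional entropy given the first coordinate is the integral of the entropies over the
fibres. -/
theorem condEntropy_comap_fst {α : Type*} [Fintype α] [MeasurableSpace α]
    [MeasurableSingletonClass α] [IsProbabilityMeasure μ₁] [IsProbabilityMeasure μ₂]
    {U : X₁ × X₂ → α} (hU : Measurable U) :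
    condEntropy (MeasurableSpace.comap (Prod.fst : X₁ × X₂ → X₁) inferInstance)
      (μ₁.prod μ₂) U = ∫ x, entropy μ₂ (fun y => U (x, y)) ∂μ₁ := by
  have h : ∀ᵐ z ∂μ₁.prod μ₂, ∀ i, μ₂.real (Prod.mk z.1 ⁻¹' (U ⁻¹' {i})) =
      ((μ₁.prod μ₂)[(U ⁻¹' {i}).indicator (fun _ => (1 : ℝ)) |
        MeasurableSpace.comap (Prod.fst : X₁ × X₂ → X₁) inferInstance]) z :=
    ae_all_iff.2 fun i => measureReal_slice_ae_eq_condExp (hU (measurableSet_singleton i))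
  have h' : condEntropy (MeasurableSpace.comap (Prod.fst : X₁ × X₂ → X₁) inferInstance)
      (μ₁.prod μ₂) U = ∫ z, entropy μ₂ (fun y => U (z.1, y)) ∂(μ₁.prod μ₂) := by
    refine integral_congr_ae ?_
    filter_upwards [h] with z hz
    refine Finset.sum_congr rfl fun i _ => ?_
    rw [← hz i]
    rfl
  rw [h', integral_fun_fst (f := fun x => entropy μ₂ (fun y => U (x, y)))]
  simp

end Product

/-! ### Processes over a product action -/

section Action

variable {Γ X₁ X₂ ι : Type*} [Group Γ]
  [MeasurableSpace X₁] {μ₁ : Measure X₁} [IsProbabilityMeasure μ₁]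
  [MulAction Γ X₁] [MeasurableConstSMul Γ X₁] [SMulInvariantMeasure Γ X₁ μ₁]
  [MeasurableSpace X₂] {μ₂ : Measure X₂} [IsProbabilityMeasure μ₂]
  [MulAction Γ X₂] [MeasurableConstSMul Γ X₂] [SMulInvariantMeasure Γ X₂ μ₂]

instance : MeasurableConstSMul Γ (X₁ × X₂) where
  measurable_const_smul γ :=
    (measurable_fst.const_smul γ).prodMk (measurable_snd.const_smul γ)

omit [IsProbabilityMeasure μ₂] in
theorem entropy_comp_smul [Fintype ι] [MeasurableSpace ι] [MeasurableSingletonClass ι]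
    {U : X₂ → ι} (hU : Measurable U) (γ : Γ) :
    entropy μ₂ (fun y => U (γ • y)) = entropy μ₂ U :=
  Finset.sum_congr rfl fun i _ => by
    rw [← (measurePreserving_smul γ μ₂).measureReal_preimage
      (hU (measurableSet_singleton i)).nullMeasurableSet]
    rfl

theorem measurable_join {X : Type*} [MeasurableSpace X] [MulAction Γ X] [MeasurableConstSMul Γ X]
    [MeasurableSpace ι] {P : X → ι} (hP : Measurable P) (F : Finset Γ) :
    Measurable (join F P) :=
  measurable_familyJoin fun γ => hP.comp (measurable_const_smul γ)

omit [SMulInvariantMeasure Γ X₂ μ₂] in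
theorem entropy_join_le [Fintype ι] [MeasurableSpace ι] [MeasurableSingletonClass ι]
    {P : X₁ × X₂ → ι} (hP : Measurable P) (F : Finset Γ) (x : X₁) :
    entropy μ₂ (fun y => join F P (x, y)) ≤ F.card * Fintype.card ι := by
  refine (entropy_familyJoin_le_sum (μ := μ₂) (Y := fun γ y => P (γ • (x, y))) (fun γ =>
    hP.comp ((measurable_const_smul γ).comp measurable_prodMk_left)) F).trans ?_
  refine (Finset.sum_le_sum fun γ _ => entropy_le_card μ₂ _).trans ?_
  simp

/-- Let `Q` be the partition `{s, sᶜ}` of `X₂`, and let `A` be a set of points of `X₁` over which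
the slice of the atom `P ⁻¹' {i}` is so close to `s` that the symmetric difference has entropy at
most `ε`. Over `x`, the join of `P` over `F` sees `Q` at the times `γ ∈ F` at which `γ • x ∈ A`, up
to an error `ε` each; these times form a random subset of `F` covering each `γ` with probability
`μ₁ A`, so Shearer's inequality applies. -/
theorem mul_entropy_join_le [Fintype ι] [MeasurableSpace ι] [MeasurableSingletonClass ι]
    {P : X₁ × X₂ → ι} (hP : Measurable P) (i : ι) {s : Set X₂} (hs : MeasurableSet s)
    {A : Set X₁} (hA : MeasurableSet A) {ε : ℝ}
    (hAε : ∀ x ∈ A, entropy μ₂ (fun y => decide (y ∈ (Prod.mk x ⁻¹' (P ⁻¹' {i})) ∆ s)) ≤ ε)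
    {Q : X₂ → Fin 2} (hQ : Q = fun y => if y ∈ s then 1 else 0) (F : Finset Γ) :
    μ₁.real A * (entropy μ₂ (join F Q) - F.card * ε) ≤
      ∫ x, entropy μ₂ (fun y => join F P (x, y)) ∂μ₁ := by
  have hQm : Measurable Q := hQ ▸ Measurable.ite hs measurable_const measurable_const
  obtain ⟨c, hc, hcR⟩ := exists_additive_le_of_submodular
    (f := fun S : Finset Γ => entropy μ₂ (familyJoin S fun γ y => Q (γ • y)))
    (entropy_familyJoin_empty _)
    (fun R S hRS a => entropy_familyJoin_submodular
      (fun γ => hQm.comp (measurable_const_smul γ)) hRS a) F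
  have hpt : ∀ x, ∑ γ ∈ F, ((γ • ·) ⁻¹' A).indicator (fun _ => c γ - ε) x ≤
      entropy μ₂ (fun y => join F P (x, y)) := by
    intro x
    have hT : ∀ γ : Γ, MeasurableSet ((Prod.mk (γ • x) ⁻¹' (P ⁻¹' {i})) ∆ s) := fun γ =>
      (measurable_prodMk_left (hP (measurableSet_singleton i))).symmDiff hs
    have hW : ∀ γ : Γ, Measurable fun y : X₂ =>
        decide (y ∈ (Prod.mk (γ • x) ⁻¹' (P ⁻¹' {i})) ∆ s) := fun γ =>
      measurable_to_bool (by
        convert hT γ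
        ext
        simp)
    have h1 := entropy_familyJoin_le_add_sum (μ := μ₂) (F := F)
      (R := F.filter fun γ => γ • x ∈ A)
      (Y := fun γ y => P (γ • (x, y))) (fun γ =>
        hP.comp ((measurable_const_smul γ).comp measurable_prodMk_left))
      (W := fun γ y => decide (γ • y ∈ (Prod.mk (γ • x) ⁻¹' (P ⁻¹' {i})) ∆ s))
      (fun γ => (hW γ).comp (measurable_const_smul γ))
      (Q := fun γ y => Q (γ • y)) (Finset.filter_subset _ _) (by
        intro γ _ y y' hY hW
        simp only [Prod.smul_mk] at hY
        simp only [decide_eq_decide, Set.mem_symmDiff, Set.mem_preimage, hY,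
          Set.mem_singleton_iff] at hW
        have : γ • y ∈ s ↔ γ • y' ∈ s := by tauto
        simp only [hQ, this])
    have h2 := hcR _ (Finset.filter_subset (fun γ => γ • x ∈ A) F)
    have h3 : ∑ γ ∈ F.filter (fun γ => γ • x ∈ A), entropy μ₂
        (fun y => decide (γ • y ∈ (Prod.mk (γ • x) ⁻¹' (P ⁻¹' {i})) ∆ s)) ≤
        ∑ γ ∈ F.filter (fun γ => γ • x ∈ A), ε := by
      refine Finset.sum_le_sum fun γ hγ => ?_
      rw [entropy_comp_smul (hW γ) γ]
      exact hAε _ (Finset.mem_filter.1 hγ).2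
    have h4 : ∑ γ ∈ F, ((γ • ·) ⁻¹' A).indicator (fun _ => c γ - ε) x =
        ∑ γ ∈ F.filter (fun γ => γ • x ∈ A), (c γ - ε) := by
      rw [Finset.sum_filter]
      rfl
    rw [h4, Finset.sum_sub_distrib]
    change _ ≤ entropy μ₂ (familyJoin F fun γ y => P (γ • (x, y)))
    linarith
  have hmeas : ∀ γ : Γ, MeasurableSet ((γ • ·) ⁻¹' A : Set X₁) := fun γ =>
    measurable_const_smul γ hA
  have hint : ∀ γ ∈ F, Integrable (((γ • ·) ⁻¹' A).indicator fun _ => c γ - ε) μ₁ := fun γ _ =>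
    (integrable_const _).indicator (hmeas γ)
  have h5 := integral_mono (integrable_finsetSum F hint)
    (integrable_entropy_slice (μ₁ := μ₁) (μ₂ := μ₂) (measurable_join hP F)) hpt
  rw [integral_finsetSum F hint] at h5
  refine le_trans (le_of_eq ?_) h5
  have h6 : ∀ γ ∈ F, ∫ x, ((γ • ·) ⁻¹' A).indicator (fun _ => c γ - ε) x ∂μ₁ =
      μ₁.real A * (c γ - ε) := by
    intro γ _
    rw [integral_indicator_const _ (hmeas γ),
      (measurePreserving_smul γ μ₁).measureReal_preimage hA.nullMeasurableSet, smul_eq_mul]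
  rw [Finset.sum_congr rfl h6, ← Finset.mul_sum, Finset.sum_sub_distrib, hc, Finset.sum_const,
    nsmul_eq_mul]
  rfl

/-- If `X₂` has completely positive entropy, the slices of the atoms of a partition of zero entropy
relative to `X₁` are almost surely trivial. -/
theorem ae_measure_slice_eq_zero_or_one [MeasurableSpace.CountablyGenerated X₂]
    [Fintype ι] [MeasurableSpace ι] [MeasurableSingletonClass ι]
    {H : ℕ → Finset Γ} (h₂ : IsCPE H μ₂) {P : X₁ × X₂ → ι} (hP : Measurable P)
    (h0 : condProcessEntropy (MeasurableSpace.comap (Prod.fst : X₁ × X₂ → X₁) inferInstance)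
      H (μ₁.prod μ₂) P = 0) (i : ι) :
    ∀ᵐ x ∂μ₁, μ₂ (Prod.mk x ⁻¹' (P ⁻¹' {i})) = 0 ∨ μ₂ (Prod.mk x ⁻¹' (P ⁻¹' {i})) = 1 := by
  have hS : MeasurableSet (P ⁻¹' {i}) := hP (measurableSet_singleton i)
  filter_upwards [ae_forall_measure_slice_close_pos (μ₁ := μ₁) (μ₂ := μ₂) hS] with x₀ hx₀
  by_contra hne
  rw [not_or] at hne
  set s : Set X₂ := Prod.mk x₀ ⁻¹' (P ⁻¹' {i}) with hs_def
  have hs : MeasurableSet s := measurable_prodMk_left hS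
  set Q : X₂ → Fin 2 := fun y => if y ∈ s then 1 else 0 with hQ
  have hQm : Measurable Q := Measurable.ite hs measurable_const measurable_const
  have hQs : Q ⁻¹' {1} = s := by
    ext y
    by_cases hy : y ∈ s <;> simp [hQ, hy]
  have hpos : 0 < processEntropy H μ₂ Q := h₂ 2 Q hQm ⟨1, by rwa [hQs]⟩
  -- Half of `h(T₂, Q)` absorbs the passage from the upper limit to frequently attained values,
  -- and half of what is left absorbs the error per time.
  set ε := processEntropy H μ₂ Q / 2 with hε
  have hεpos : 0 < ε := half_pos hpos
  obtain ⟨δ, hδ, hδε⟩ := exists_entropy_decide_mem_lt μ₂ (half_pos hεpos)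
  set A : Set X₁ := {x | μ₂.real ((Prod.mk x ⁻¹' (P ⁻¹' {i})) ∆ s) < δ} with hA_def
  have hA : MeasurableSet A := by
    have hpre : ∀ x, (Prod.mk x ⁻¹' (P ⁻¹' {i})) ∆ s =
        Prod.mk x ⁻¹' ((P ⁻¹' {i}) ∆ (Prod.snd ⁻¹' s)) := fun x => rfl
    simp only [hA_def, hpre]
    exact measurableSet_lt (measurable_measure_prodMk_left
      (hS.symmDiff (measurable_snd hs))).ennreal_toReal measurable_const
  have hAε : ∀ x ∈ A, entropy μ₂
      (fun y => decide (y ∈ (Prod.mk x ⁻¹' (P ⁻¹' {i})) ∆ s)) ≤ ε / 2 := fun x hx =>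
    (hδε _ ((measurable_prodMk_left hS).symmDiff hs) hx).le
  have hApos : 0 < μ₁.real A :=
    ENNReal.toReal_pos (hx₀ δ hδ) (measure_ne_top _ _)
  have hfreq : ∃ᶠ n in atTop, ε < entropy μ₂ (join (H n) Q) / ((H n).card : ℝ) := by
    refine frequently_lt_of_lt_limsup ?_ (half_lt_self hpos)
    exact (isBoundedUnder_of ⟨0, fun n =>
      div_nonneg (entropy_nonneg _) (Nat.cast_nonneg _)⟩ :
        IsBoundedUnder (· ≥ ·) atTop _).isCoboundedUnder_le
  have hle : μ₁.real A * (ε / 2) ≤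
      condProcessEntropy (MeasurableSpace.comap (Prod.fst : X₁ × X₂ → X₁) inferInstance)
        H (μ₁.prod μ₂) P := by
    refine le_limsup_of_frequently_le (hfreq.mono fun n hn => ?_) (isBoundedUnder_of
      ⟨Fintype.card ι, fun n => ?_⟩)
    · rw [condEntropy_comap_fst (measurable_join hP (H n))]
      -- A division by an empty `H n` would yield the value `0 < ε`.
      have hcard : (0 : ℝ) < (H n).card := by
        rcases (Nat.cast_nonneg (α := ℝ) (H n).card).eq_or_lt with h | h
        · rw [← h, div_zero] at hn
          exact absurd hn hεpos.not_gt
        · exact h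
      rw [lt_div_iff₀ hcard] at hn
      rw [le_div_iff₀ hcard]
      refine le_trans ?_ (mul_entropy_join_le (μ₁ := μ₁) hP i hs hA hAε hQ (H n))
      rw [mul_assoc]
      exact mul_le_mul_of_nonneg_left (by linarith) hApos.le
    · rw [condEntropy_comap_fst (measurable_join hP (H n))]
      refine div_le_of_le_mul₀ (Nat.cast_nonneg _) (Nat.cast_nonneg _) ?_
      refine (integral_mono (integrable_entropy_slice (measurable_join hP (H n)))
        (integrable_const _) (entropy_join_le hP (H n))).trans (le_of_eq ?_)
      simp [mul_comm]
  rw [h0] at hle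
  exact absurd hle (mul_pos hApos (half_pos hεpos)).not_ge

/-! ### The relative Pinsker algebra -/

omit [IsProbabilityMeasure μ₁] in
theorem ae_eq_preimage_fst_of_slice {S : Set (X₁ × X₂)} (hS : MeasurableSet S)
    (h : ∀ᵐ x ∂μ₁, μ₂ (Prod.mk x ⁻¹' S) = 0 ∨ μ₂ (Prod.mk x ⁻¹' S) = 1) [SFinite μ₁] :
    S =ᵐ[μ₁.prod μ₂] Prod.fst ⁻¹' {x | μ₂ (Prod.mk x ⁻¹' S) = 1} := by
  have hm : MeasurableSet {x | μ₂ (Prod.mk x ⁻¹' S) = 1} :=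
    measurable_measure_prodMk_left hS (measurableSet_singleton 1)
  rw [← measure_symmDiff_eq_zero_iff,
    Measure.measure_prod_null (hS.symmDiff (measurable_fst hm))]
  filter_upwards [h] with x hx
  rcases hx with hx | hx
  · refine measure_mono_null (fun y hy => ?_) hx
    rcases hy with hy | hy
    · exact hy.1
    · have : μ₂ (Prod.mk x ⁻¹' S) = 1 := hy.1
      simp [hx] at this
  · refine measure_mono_null (t := (Prod.mk x ⁻¹' S)ᶜ) (fun y hy => ?_)
      ((prob_compl_eq_zero_iff (measurable_prodMk_left hS)).2 hx)
    rcases hy with hy | hy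
    · exact absurd hx hy.2
    · exact hy.2

omit [SMulInvariantMeasure Γ X₁ μ₁] [SMulInvariantMeasure Γ X₂ μ₂] in
/-- A partition that depends only on the first coordinate has zero entropy relative to it. -/
theorem condProcessEntropy_comap_fst_of_comp_fst [Fintype ι] [MeasurableSpace ι]
    [MeasurableSingletonClass ι] (H : ℕ → Finset Γ) {p : X₁ → ι} (hp : Measurable p) :
    condProcessEntropy (MeasurableSpace.comap (Prod.fst : X₁ × X₂ → X₁) inferInstance)
      H (μ₁.prod μ₂) (fun z => p z.1) = 0 := by
  have h : ∀ n, condEntropy (MeasurableSpace.comap (Prod.fst : X₁ × X₂ → X₁) inferInstance)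
      (μ₁.prod μ₂) (join (H n) fun z => p z.1) = 0 := by
    intro n
    have hm : Measurable fun z : X₁ × X₂ => p z.1 := hp.comp measurable_fst
    rw [condEntropy_comap_fst (measurable_join hm (H n))]
    have h' : ∀ x, entropy μ₂ (fun y : X₂ => join (H n) (fun z : X₁ × X₂ => p z.1) (x, y)) = 0 := by
      intro x
      refine le_antisymm ?_ (entropy_nonneg _)
      refine (entropy_le_of_factorsThrough (V := familyJoin (∅ : Finset Γ) fun _ _ => (0 : Fin 2))
        (measurable_familyJoin fun _ => measurable_const) fun y y' _ => rfl).trans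
        (entropy_familyJoin_empty _).le
    simp [h']
  simp [condProcessEntropy, h]

theorem isRelCPE_comap_fst [MeasurableSpace.CountablyGenerated X₂]
    {H : ℕ → Finset Γ} (h₂ : IsCPE H μ₂) :
    IsRelCPE (MeasurableSpace.comap (Prod.fst : X₁ × X₂ → X₁) inferInstance) H
      (μ₁.prod μ₂) := by
  refine ⟨fun s hs => ?_, ?_⟩
  · induction s, hs using MeasurableSpace.generateFrom_induction with
    | hC s hs _ =>
      obtain ⟨n, P, hP, h0, i, rfl⟩ := hs
      have hS : MeasurableSet (P ⁻¹' {i}) := hP (measurableSet_singleton i)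
      exact ⟨_, ⟨_, measurable_measure_prodMk_left hS (measurableSet_singleton 1), rfl⟩,
        ae_eq_preimage_fst_of_slice hS (ae_measure_slice_eq_zero_or_one h₂ hP h0 i)⟩
    | empty => exact ⟨∅, @MeasurableSet.empty _ (_), EventuallyEq.rfl⟩
    | compl s _ ih =>
      obtain ⟨t, ht, hst⟩ := ih
      exact ⟨tᶜ, @MeasurableSet.compl _ _ (_) ht, hst.compl⟩
    | iUnion s _ ih =>
      choose t ht hst using ih
      exact ⟨⋃ n, t n, @MeasurableSet.iUnion _ _ (_) _ _ ht, Filter.EventuallyEq.countable_iUnion hst⟩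
  · rintro _ ⟨B, hB, rfl⟩
    have hp : Measurable fun x : X₁ => if x ∈ B then (1 : Fin 2) else 0 :=
      Measurable.ite hB measurable_const measurable_const
    have hatom : (Prod.fst : X₁ × X₂ → X₁) ⁻¹' B =
        (fun z : X₁ × X₂ => if z.1 ∈ B then (1 : Fin 2) else 0) ⁻¹' {1} := by
      ext z
      by_cases hz : z.1 ∈ B <;> simp [hz]
    refine ⟨Prod.fst ⁻¹' B, ?_, EventuallyEq.rfl⟩
    have hm : Measurable fun z : X₁ × X₂ => if z.1 ∈ B then (1 : Fin 2) else 0 :=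
      hp.comp measurable_fst
    have hcond := condProcessEntropy_comap_fst_of_comp_fst (μ₁ := μ₁) (μ₂ := μ₂) H hp
    exact MeasurableSpace.measurableSet_generateFrom ⟨2, _, hm, hcond, 1, hatom⟩

end Action
end AmenableEntropy

theorem corollary4p11 {Γ X₁ X₂ : Type*}
    [Group Γ] [Countable Γ] [MeasurableSpace Γ] [DiscreteMeasurableSpace Γ]
    (H : ℕ → Finset Γ)
    (hH : IsFoelner Γ (Measure.count : Measure Γ) atTop (fun i => (H i : Set Γ)))
    [MeasurableSpace X₁] [StandardBorelSpace X₁] (μ₁ : Measure X₁) [IsProbabilityMeasure μ₁]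
    [MulAction Γ X₁] [MeasurableConstSMul Γ X₁] [SMulInvariantMeasure Γ X₁ μ₁]
    [MeasurableSpace X₂] [StandardBorelSpace X₂] (μ₂ : Measure X₂) [IsProbabilityMeasure μ₂]
    [MulAction Γ X₂] [MeasurableConstSMul Γ X₂] [SMulInvariantMeasure Γ X₂ μ₂]
    (h₁ : AmenableEntropy.IsBernoulli Γ μ₁)
    (h₂ : AmenableEntropy.IsCPE H μ₂) :
    AmenableEntropy.IsRelCPE
      (MeasurableSpace.comap (Prod.fst : X₁ × X₂ → X₁) inferInstance) H (μ₁.prod μ₂) :=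
  AmenableEntropy.isRelCPE_comap_fst h₂
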